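/- Let $\mathfrak g$ be a complex Lie algebra (possibly infinite-dimensional) with a triangular decomposition $\mathfrak g=\mathfrak n_-\oplus\mathfrak h\oplus\mathfrak n_+$ in the sense of Moody and Pianzola: $\mathfrak n_-,\mathfrak h,\mathfrak n_+$ are Lie subalgebras, $\mathfrak h$ is abelian, $\mathfrak n_+$ is the direct sum of its $\mathrm{ad}\,\mathfrak h$-weight spaces, all of whose weights lie in $Q_+\setminus\{0\}$, where $Q_+\subset\mathfrak h^*$ is the additive monoid generated by a linearly independent set, and there is an anti-involution $\sigma$ of $\mathfrak g$ that fixes $\mathfrak h$ pointwise and satisfies $\sigma(\mathfrak n_+)=\mathfrak n_-$. Put $\mathfrak n=\mathfrak n_+$. For $\mu\in\mathfrak h^*$ let $M(\mu)=U(\mathfrak g)\otimes_{U(\mathfrak h\oplus\mathfrak n_+)}\mathbb C_\mu$ be the Verma module with highest weight $\mu$, let $N(-\mu)=U(\mathfrak g)\otimes_{U(\mathfrak h\oplus\mathfrak n_-)}\mathbb C_{-\mu}$ be the lowest weight Verma module with lowest weight $-\mu$, and let $N(-\mu)^*$ be its full dual, with the action $(xf)(w)=f(-xw)$ for $x\in\mathfrak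 g$. For a Lie algebra homomorphism $\lambda:\mathfrak n\to\mathbb C$, that is, $\lambda\in(\mathfrak n/[\mathfrak n,\mathfrak n])^*$, let $L_\lambda=\mathbb C v_\lambda$ be the corresponding one-dimensional $\mathfrak n$-module, let $M_\lambda=U(\mathfrak g)\otimes_{U(\mathfrak n)}L_\lambda$, and for a $\mathfrak g$-module $X$ let $W_\lambda(X)=\{v\in X: xv=\lambda(x)v \text{ for all } x\in\mathfrak n\}$. Assume that $\mu\in\mathfrak h^*$ is such that $M(\mu)$ is simple, and let $\lambda\in(\mathfrak n/[\mathfrak n,\mathfrak n])^*$. Then the space $W_\lambda(N(-\mu)^*)$ is one-dimensional, and the image $L(\lambda,\mu)$ of the $\mathfrak g$-module homomorphism $M_\lambda\to N(-\mu)^*$ that sends $v_\lambda$ to a nonzero vector of $W_\lambda(N(-\mu)^*)$ (which is unique up to a scalar) satisfies $$\mathrm{Ann}_{U(\mathfrak g)}L(\lambda,\mu)=\mathrm{Ann}_{U(\mathfrak g)}M(\mu).$$ -/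

import Mathlib

open scoped TensorProduct

attribute [local instance 100] LieRing.ofAssociativeRing

noncomputable section

namespace WhittakerModules

section General

variable {g : Type*} [LieRing g] [LieAlgebra ℂ g]

/-- The annihilator in `U(g)` of a `g`-module `M`: the kernel of the representation
`U(g) → End(M)`. -/
def annihilator (g : Type*) [LieRing g] [LieAlgebra ℂ g] (M : Type*) [AddCommGroup M]
    [Module ℂ M] [LieRingModule g M] [LieModule ℂ g M] :
    Ideal (UniversalEnvelopingAlgebra ℂ g) :=
  RingHom.ker (UniversalEnvelopingAlgebra.lift ℂ (LieModule.toEnd ℂ g M))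

/-- The algebra homomorphism `U(s) → U(g)` coming from the inclusion of a subalgebra. -/
def envIncl (s : LieSubalgebra ℂ g) :
    UniversalEnvelopingAlgebra ℂ s →ₐ[ℂ] UniversalEnvelopingAlgebra ℂ g :=
  UniversalEnvelopingAlgebra.lift ℂ ((UniversalEnvelopingAlgebra.ι ℂ).comp s.incl)

/-- The representation of a Lie algebra `s` on the one-dimensional space `ℂ` given by a
character. -/
def charRep {s : Type*} [LieRing s] [LieAlgebra ℂ s] (χ : LieAlgebra.LieCharacter ℂ s) :
    s →ₗ⁅ℂ⁆ Module.End ℂ ℂ where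
  toFun x := χ x • LinearMap.id
  map_add' x y := by simp [add_smul]
  map_smul' c x := by simp [mul_smul]
  map_lie' {x y} := by
    ext
    simp [LieRing.of_associative_ring_bracket, mul_comm]

section Induced

variable {V : Type*} [AddCommGroup V] [Module ℂ V]

/-- The `U(s)`-balancing relations `u a ⊗ v = u ⊗ a v` in `U(g) ⊗_ℂ V`, for a representation
`φ` of a subalgebra `s` on `V`. -/
def balancing (s : LieSubalgebra ℂ g) (φ : s →ₗ⁅ℂ⁆ Module.End ℂ V) :
    Submodule (UniversalEnvelopingAlgebra ℂ g) (UniversalEnvelopingAlgebra ℂ g ⊗[ℂ] V) :=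
  Submodule.span _ {t | ∃ (u : UniversalEnvelopingAlgebra ℂ g)
    (a : UniversalEnvelopingAlgebra ℂ s) (v : V),
    t = (u * envIncl s a) ⊗ₜ[ℂ] v
      - u ⊗ₜ[ℂ] (UniversalEnvelopingAlgebra.lift ℂ φ a v)}

/-- The induced module `U(g) ⊗_{U(s)} V`, with its left action of `U(g)`. -/
def Induced (s : LieSubalgebra ℂ g) (φ : s →ₗ⁅ℂ⁆ Module.End ℂ V) : Type _ :=
  (UniversalEnvelopingAlgebra ℂ g ⊗[ℂ] V) ⧸ balancing s φ

namespace Induced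

variable (s : LieSubalgebra ℂ g) (φ : s →ₗ⁅ℂ⁆ Module.End ℂ V)

instance : AddCommGroup (Induced s φ) :=
  inferInstanceAs (AddCommGroup ((UniversalEnvelopingAlgebra ℂ g ⊗[ℂ] V) ⧸ balancing s φ))

instance : Module (UniversalEnvelopingAlgebra ℂ g) (Induced s φ) :=
  inferInstanceAs (Module (UniversalEnvelopingAlgebra ℂ g)
    ((UniversalEnvelopingAlgebra ℂ g ⊗[ℂ] V) ⧸ balancing s φ))

instance : Module ℂ (Induced s φ) :=
  inferInstanceAs (Module ℂ ((UniversalEnvelopingAlgebra ℂ g ⊗[ℂ] V) ⧸ balancing s φ))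

instance : IsScalarTower ℂ (UniversalEnvelopingAlgebra ℂ g) (Induced s φ) :=
  inferInstanceAs (IsScalarTower ℂ (UniversalEnvelopingAlgebra ℂ g)
    ((UniversalEnvelopingAlgebra ℂ g ⊗[ℂ] V) ⧸ balancing s φ))

/-- The class of the tensor `u ⊗ v`. -/
def tmul (u : UniversalEnvelopingAlgebra ℂ g) (v : V) : Induced s φ :=
  (balancing s φ).mkQ (u ⊗ₜ[ℂ] v)

instance : LieRingModule g (Induced s φ) where
  bracket x m := UniversalEnvelopingAlgebra.ι ℂ x • m
  add_lie x y m := by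
    change UniversalEnvelopingAlgebra.ι ℂ (x + y) • m = _
    rw [map_add, add_smul]
  lie_add x m n := smul_add _ m n
  leibniz_lie x y m := by
    change UniversalEnvelopingAlgebra.ι ℂ x • (UniversalEnvelopingAlgebra.ι ℂ y • m)
      = UniversalEnvelopingAlgebra.ι ℂ ⁅x, y⁆ • m
        + UniversalEnvelopingAlgebra.ι ℂ y • (UniversalEnvelopingAlgebra.ι ℂ x • m)
    rw [LieHom.map_lie, LieRing.of_associative_ring_bracket, sub_smul, mul_smul, mul_smul]
    abel

instance : LieModule ℂ g (Induced s φ) where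
  smul_lie c x m := by
    change UniversalEnvelopingAlgebra.ι ℂ (c • x) • m
      = c • (UniversalEnvelopingAlgebra.ι ℂ x • m)
    rw [map_smul, smul_assoc]
  lie_smul c x m := by
    change UniversalEnvelopingAlgebra.ι ℂ x • (c • m)
      = c • (UniversalEnvelopingAlgebra.ι ℂ x • m)
    rw [← algebraMap_smul (UniversalEnvelopingAlgebra ℂ g) c m,
      ← algebraMap_smul (UniversalEnvelopingAlgebra ℂ g) c
        (UniversalEnvelopingAlgebra.ι ℂ x • m), ← mul_smul, ← mul_smul, Algebra.commutes]

end Induced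

end Induced

section Whittaker

variable (n : LieSubalgebra ℂ g) (χ : LieAlgebra.LieCharacter ℂ n)

/-- The standard Whittaker module `M_λ = U(g) ⊗_{U(n)} L_λ`, where `L_λ` is the
one-dimensional `n`-module `ℂ` given by the character `λ`, with basis vector `1`. -/
abbrev StandardWhittaker : Type _ := Induced n (charRep χ)

/-- The generator `1 ⊗ v_λ` of `M_λ`. -/
def standardGenerator : StandardWhittaker n χ := Induced.tmul n (charRep χ) 1 1

variable (M : Type*) [AddCommGroup M] [Module ℂ M] [LieRingModule g M] [LieModule ℂ g M]

/-- The space `W_λ(M)` of the vectors of `M` on which `n` acts through the character `λ`. -/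
def whittakerVectors : Submodule ℂ M where
  carrier := {m | ∀ x : n, ⁅(x : g), m⁆ = χ x • m}
  zero_mem' x := by simp
  add_mem' ha hb x := by rw [lie_add, ha x, hb x, smul_add]
  smul_mem' c m hm x := by rw [lie_smul, hm x, smul_comm]

variable {n χ M}

/-- The map `U(g) ⊗_ℂ L_λ → M`, `u ⊗ z ↦ z u w`. -/
def preWhittakerHom (w : M) :
    (UniversalEnvelopingAlgebra ℂ g ⊗[ℂ] ℂ) →ₛₗ[((UniversalEnvelopingAlgebra.lift ℂ
      (LieModule.toEnd ℂ g M) : UniversalEnvelopingAlgebra ℂ g →ₐ[ℂ] Module.End ℂ M) :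
      UniversalEnvelopingAlgebra ℂ g →+* Module.End ℂ M)] M where
  toFun t := UniversalEnvelopingAlgebra.lift ℂ (LieModule.toEnd ℂ g M)
    (TensorProduct.rid ℂ (UniversalEnvelopingAlgebra ℂ g) t) w
  map_add' a b := by simp
  map_smul' u t := by
    have h : TensorProduct.rid ℂ (UniversalEnvelopingAlgebra ℂ g) (u • t)
        = u * TensorProduct.rid ℂ (UniversalEnvelopingAlgebra ℂ g) t := by
      induction t with
      | zero => simp
      | tmul a z => simp [TensorProduct.smul_tmul']
      | add a b ha hb => rw [smul_add, map_add, ha, hb, map_add, mul_add]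
    rw [h, map_mul]
    rfl

theorem lift_envIncl_apply (w : M) (hw : w ∈ whittakerVectors n χ M)
    (a : UniversalEnvelopingAlgebra ℂ n) :
    UniversalEnvelopingAlgebra.lift ℂ (LieModule.toEnd ℂ g M) (envIncl n a) w
      = (UniversalEnvelopingAlgebra.lift ℂ (charRep χ) a 1) • w := by
  have hs : ∀ (b : UniversalEnvelopingAlgebra ℂ n) (z : ℂ),
      UniversalEnvelopingAlgebra.lift ℂ (charRep χ) b z
        = z * UniversalEnvelopingAlgebra.lift ℂ (charRep χ) b 1 := by
    intro b z
    rw [← smul_eq_mul, ← map_smul, smul_eq_mul, mul_one]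
  let S : Subalgebra ℂ (UniversalEnvelopingAlgebra ℂ n) :=
    { carrier := {a | UniversalEnvelopingAlgebra.lift ℂ (LieModule.toEnd ℂ g M)
        (envIncl n a) w = (UniversalEnvelopingAlgebra.lift ℂ (charRep χ) a 1) • w}
      mul_mem' := by
        intro a b ha hb
        simp only [Set.mem_ofPred_eq] at ha hb ⊢
        rw [map_mul, map_mul, map_mul, Module.End.mul_apply, Module.End.mul_apply, hb,
          map_smul, ha, hs a (UniversalEnvelopingAlgebra.lift ℂ (charRep χ) b 1), mul_smul]
      add_mem' := by
        intro a b ha hb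
        simp only [Set.mem_ofPred_eq] at ha hb ⊢
        rw [map_add, map_add, map_add, LinearMap.add_apply, LinearMap.add_apply, ha, hb,
          add_smul]
      algebraMap_mem' := by
        intro c
        simp }
  have hι : ∀ x : n, UniversalEnvelopingAlgebra.ι ℂ x ∈ S := by
    intro x
    change UniversalEnvelopingAlgebra.lift ℂ (LieModule.toEnd ℂ g M)
      (envIncl n (UniversalEnvelopingAlgebra.ι ℂ x)) w
      = (UniversalEnvelopingAlgebra.lift ℂ (charRep χ) (UniversalEnvelopingAlgebra.ι ℂ x) 1) • w
    rw [envIncl, UniversalEnvelopingAlgebra.lift_ι_apply, UniversalEnvelopingAlgebra.lift_ι_apply]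
    change UniversalEnvelopingAlgebra.lift ℂ (LieModule.toEnd ℂ g M)
      (UniversalEnvelopingAlgebra.ι ℂ (x : g)) w = (χ x • (1 : ℂ)) • w
    rw [UniversalEnvelopingAlgebra.lift_ι_apply, smul_eq_mul, mul_one]
    exact hw x
  let F : n →ₗ⁅ℂ⁆ S :=
    { toFun := fun x => ⟨UniversalEnvelopingAlgebra.ι ℂ x, hι x⟩
      map_add' := fun x y => Subtype.ext (map_add _ x y)
      map_smul' := fun c x => Subtype.ext (map_smul _ c x)
      map_lie' := fun {x y} => Subtype.ext (LieHom.map_lie _ x y) }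
  have hF : S.val.comp (UniversalEnvelopingAlgebra.lift ℂ F) = AlgHom.id ℂ _ := by
    apply UniversalEnvelopingAlgebra.hom_ext
    ext x
    change ((UniversalEnvelopingAlgebra.lift ℂ F (UniversalEnvelopingAlgebra.ι ℂ x) : S) :
      UniversalEnvelopingAlgebra ℂ n) = UniversalEnvelopingAlgebra.ι ℂ x
    rw [UniversalEnvelopingAlgebra.lift_ι_apply]
    rfl
  have h := (UniversalEnvelopingAlgebra.lift ℂ F a).2
  have h2 : ((UniversalEnvelopingAlgebra.lift ℂ F a : S) : UniversalEnvelopingAlgebra ℂ n) = a :=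
    DFunLike.congr_fun hF a
  rw [h2] at h
  exact h

theorem balancing_le_ker (w : M) (hw : w ∈ whittakerVectors n χ M) :
    balancing n (charRep χ) ≤ LinearMap.ker (preWhittakerHom (g := g) w) := by
  refine Submodule.span_le.2 ?_
  rintro _ ⟨u, a, v, rfl⟩
  have hv : UniversalEnvelopingAlgebra.lift ℂ (charRep χ) a v
      = v * UniversalEnvelopingAlgebra.lift ℂ (charRep χ) a 1 := by
    rw [← smul_eq_mul, ← map_smul, smul_eq_mul, mul_one]
  change preWhittakerHom (g := g) w _ = 0
  rw [map_sub, sub_eq_zero, hv]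
  simp [preWhittakerHom, lift_envIncl_apply w hw, mul_smul]

/-- The homomorphism of `g`-modules `M_λ → M` that sends `v_λ` to a given vector `w` of
`W_λ(M)`, that is, `u ⊗ v_λ ↦ u w`. -/
def whittakerHom (w : whittakerVectors n χ M) : StandardWhittaker n χ →ₗ⁅ℂ,g⁆ M where
  toFun := (balancing n (charRep χ)).liftQ (preWhittakerHom (w : M))
    (balancing_le_ker (w : M) w.2)
  map_add' := map_add _
  map_smul' c m := by
    rw [← algebraMap_smul (UniversalEnvelopingAlgebra ℂ g) c m]
    refine (map_smulₛₗ ((balancing n (charRep χ)).liftQ (preWhittakerHom (w : M))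
      (balancing_le_ker (w : M) w.2)) _ m).trans ?_
    simp
    rfl
  map_lie' {x m} := by
    refine (map_smulₛₗ ((balancing n (charRep χ)).liftQ (preWhittakerHom (w : M))
      (balancing_le_ker (w : M) w.2)) (UniversalEnvelopingAlgebra.ι ℂ x) m).trans ?_
    simp
    rfl

theorem whittakerHom_generator (w : whittakerVectors n χ M) :
    whittakerHom w (standardGenerator n χ) = (w : M) := by
  change preWhittakerHom (w : M) _ = _
  simp [preWhittakerHom]

end Whittaker

end General

variable (g : Type*) [LieRing g] [LieAlgebra ℂ g]

/-- The subspace of weight `β` of `g` for the adjoint action of a subalgebra `h`. -/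
def rootSpace {g : Type*} [LieRing g] [LieAlgebra ℂ g] (h : LieSubalgebra ℂ g)
    (β : Module.Dual ℂ h) : Submodule ℂ g where
  carrier := {x | ∀ y : h, ⁅(y : g), x⁆ = β y • x}
  zero_mem' y := by simp
  add_mem' ha hb y := by rw [lie_add, ha y, hb y, smul_add]
  smul_mem' c x hx y := by rw [lie_smul, hx y, smul_comm]

/-- A triangular decomposition `g = n₋ ⊕ h ⊕ n₊` of a complex Lie algebra in the sense of
Moody and Pianzola. Neither the number of simple roots nor the dimensions of the root spaces
are assumed to be finite. -/
structure TriangularDecomposition where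
  /-- The subalgebra `n₋`. -/
  neg : LieSubalgebra ℂ g
  /-- The subalgebra `h`. -/
  cartan : LieSubalgebra ℂ g
  /-- The subalgebra `n₊`. -/
  pos : LieSubalgebra ℂ g
  /-- `g` is the direct sum of the three subalgebras as a vector space. -/
  isInternal : DirectSum.IsInternal ![neg.toSubmodule, cartan.toSubmodule, pos.toSubmodule]
  /-- `h` is abelian. -/
  cartan_abelian : ∀ x ∈ cartan, ∀ y ∈ cartan, ⁅x, y⁆ = 0
  /-- The basis of the free additive monoid `Q₊ ⊆ h*`. -/
  simpleRoots : Set (Module.Dual ℂ cartan)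
  /-- The simple roots are linearly independent. -/
  linearIndepOn : LinearIndepOn ℂ id simpleRoots
  /-- `n₊` is the sum of its subspaces of weights from `Q₊ \ {0}`. -/
  pos_eq : pos.toSubmodule = ⨆ β ∈ {β : Module.Dual ℂ cartan |
    β ∈ AddSubmonoid.closure simpleRoots ∧ β ≠ 0}, rootSpace cartan β ⊓ pos.toSubmodule
  /-- The anti-involution `σ`. -/
  sigma : g →ₗ[ℂ] g
  sigma_lie : ∀ x y, sigma ⁅x, y⁆ = ⁅sigma y, sigma x⁆
  sigma_sigma : ∀ x, sigma (sigma x) = x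
  /-- `σ` fixes `h` pointwise. -/
  sigma_cartan : ∀ x ∈ cartan, sigma x = x
  /-- `σ` maps `n₊` onto `n₋`. -/
  map_sigma : pos.toSubmodule.map sigma = neg.toSubmodule

namespace TriangularDecomposition

variable {g} (T : TriangularDecomposition g)

theorem cartan_lie_pos : ∀ x ∈ T.cartan, ∀ y ∈ T.pos, ⁅x, y⁆ ∈ T.pos := by
  intro x hx y hy
  have hy' : y ∈ ⨆ β ∈ {β : Module.Dual ℂ T.cartan |
    β ∈ AddSubmonoid.closure T.simpleRoots ∧ β ≠ 0},
      rootSpace T.cartan β ⊓ T.pos.toSubmodule := T.pos_eq ▸ hy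
  have hle : (⨆ β ∈ {β : Module.Dual ℂ T.cartan |
    β ∈ AddSubmonoid.closure T.simpleRoots ∧ β ≠ 0},
      rootSpace T.cartan β ⊓ T.pos.toSubmodule) ≤
        T.pos.toSubmodule.comap (LieAlgebra.ad ℂ g x : g →ₗ[ℂ] g) := by
    refine iSup₂_le fun β _ z hz => ?_
    have h1 : ⁅x, z⁆ = β ⟨x, hx⟩ • z := hz.1 ⟨x, hx⟩
    change ⁅x, z⁆ ∈ T.pos.toSubmodule
    rw [h1]
    exact T.pos.toSubmodule.smul_mem _ hz.2
  exact hle hy'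

theorem cartan_lie_neg : ∀ x ∈ T.cartan, ∀ y ∈ T.neg, ⁅x, y⁆ ∈ T.neg := by
  intro x hx y hy
  have hy' : y ∈ T.pos.toSubmodule.map T.sigma := T.map_sigma.symm ▸ hy
  obtain ⟨z, hz, rfl⟩ := hy'
  have h1 : ⁅x, T.sigma z⁆ = T.sigma (-⁅x, z⁆) := by
    rw [lie_skew, T.sigma_lie, T.sigma_cartan x hx]
  have h2 : T.sigma (-⁅x, z⁆) ∈ T.pos.toSubmodule.map T.sigma :=
    ⟨_, T.pos.toSubmodule.neg_mem (T.cartan_lie_pos x hx z hz), rfl⟩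
  rw [h1]
  rw [T.map_sigma] at h2
  exact h2

theorem isCompl_cartan :
    IsCompl T.cartan.toSubmodule (T.neg.toSubmodule ⊔ T.pos.toSubmodule) := by
  have h := (DirectSum.isInternal_submodule_iff_iSupIndep_and_iSup_eq_top _).1 T.isInternal
  have h1 : (⨆ j, ⨆ (_ : j ≠ (1 : Fin 3)),
      (![T.neg.toSubmodule, T.cartan.toSubmodule, T.pos.toSubmodule] j))
      = T.neg.toSubmodule ⊔ T.pos.toSubmodule := by
    apply le_antisymm
    · refine iSup₂_le fun j hj => ?_
      fin_cases j
      · exact le_sup_left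
      · exact absurd rfl hj
      · exact le_sup_right
    · exact sup_le (le_iSup₂_of_le (0 : Fin 3) (by decide) le_rfl)
        (le_iSup₂_of_le (2 : Fin 3) (by decide) le_rfl)
  refine ⟨?_, codisjoint_iff_le_sup.2 ?_⟩
  · have h2 := h.1 1
    rw [h1] at h2
    exact h2
  · rw [← h.2]
    refine iSup_le fun j => ?_
    fin_cases j
    · exact le_sup_left.trans le_sup_right
    · exact le_sup_left
    · exact le_sup_right.trans le_sup_right

/-- The projection of `g` onto `h` along `n₋ ⊕ n₊`. -/
def proj : g →ₗ[ℂ] T.cartan := Submodule.projectionOnto _ _ T.isCompl_cartan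

theorem proj_cartan (x : T.cartan) : T.proj (x : g) = x :=
  Submodule.projectionOnto_apply_left T.isCompl_cartan x

/-- The subalgebra `h ⊕ n` for a subalgebra `n` of `g` normalized by `h`. -/
def borel (n : LieSubalgebra ℂ g) (hn : ∀ x ∈ T.cartan, ∀ y ∈ n, ⁅x, y⁆ ∈ n) :
    LieSubalgebra ℂ g where
  toSubmodule := T.cartan.toSubmodule ⊔ n.toSubmodule
  lie_mem' := by
    intro x y hx hy
    obtain ⟨a, ha, b, hb, rfl⟩ := Submodule.mem_sup.1 hx
    obtain ⟨c, hc, d, hd, rfl⟩ := Submodule.mem_sup.1 hy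
    refine Submodule.mem_sup_right ?_
    rw [add_lie, lie_add, lie_add, T.cartan_abelian a ha c hc, zero_add, ← lie_skew b c]
    exact n.toSubmodule.add_mem (hn a ha d hd)
      (n.toSubmodule.add_mem (n.toSubmodule.neg_mem (hn c hc b hb)) (n.lie_mem hb hd))

/-- The character `x + y ↦ ν(x)`, for `x ∈ h` and `y ∈ n`, of the subalgebra `h ⊕ n`, where
`n` is contained in `n₋ ⊕ n₊` (it is `n₊` or `n₋` below). -/
def borelChar (n : LieSubalgebra ℂ g) (hn : ∀ x ∈ T.cartan, ∀ y ∈ n, ⁅x, y⁆ ∈ n)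
    (hle : n.toSubmodule ≤ T.neg.toSubmodule ⊔ T.pos.toSubmodule)
    (ν : Module.Dual ℂ T.cartan) : LieAlgebra.LieCharacter ℂ (T.borel n hn) where
  toLinearMap := ν ∘ₗ T.proj ∘ₗ (T.borel n hn).toSubmodule.subtype
  map_lie' {x y} := by
    have key : ∀ z ∈ n, T.proj z = 0 := fun z hz =>
      (Submodule.projectionOnto_apply_eq_zero_iff T.isCompl_cartan).2 (hle hz)
    obtain ⟨x, hx⟩ := x
    obtain ⟨y, hy⟩ := y
    obtain ⟨a, ha, b, hb, rfl⟩ := Submodule.mem_sup.1 hx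
    obtain ⟨c, hc, d, hd, rfl⟩ := Submodule.mem_sup.1 hy
    have h1 : ⁅a + b, c + d⁆ ∈ n := by
      rw [add_lie, lie_add, lie_add, T.cartan_abelian a ha c hc, zero_add, ← lie_skew b c]
      exact n.toSubmodule.add_mem (hn a ha d hd)
        (n.toSubmodule.add_mem (n.toSubmodule.neg_mem (hn c hc b hb)) (n.lie_mem hb hd))
    rw [LieRing.of_associative_ring_bracket, mul_comm, sub_self]
    change ν (T.proj ⁅a + b, c + d⁆) = 0
    rw [key _ h1, map_zero]

/-- The Verma module `M(μ) = U(g) ⊗_{U(h ⊕ n₊)} ℂ_μ` with highest weight `μ`. -/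
abbrev Verma (μ : Module.Dual ℂ T.cartan) : Type _ :=
  Induced (T.borel T.pos T.cartan_lie_pos)
    (charRep (T.borelChar T.pos T.cartan_lie_pos le_sup_right μ))

/-- The lowest weight Verma module `N(ν) = U(g) ⊗_{U(h ⊕ n₋)} ℂ_ν` with lowest weight `ν`. -/
abbrev LowestVerma (ν : Module.Dual ℂ T.cartan) : Type _ :=
  Induced (T.borel T.neg T.cartan_lie_neg)
    (charRep (T.borelChar T.neg T.cartan_lie_neg le_sup_left ν))

/-- The full dual `N(-μ)*`, with the action `(x f)(w) = f(-x w)` of `g`. -/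
abbrev DualLowestVerma (μ : Module.Dual ℂ T.cartan) : Type _ :=
  Module.Dual ℂ (T.LowestVerma (-μ))

/-- For a Whittaker vector `w ∈ W_λ(N(-μ)*)`, the image of the homomorphism `M_λ → N(-μ)*`
with `v_λ ↦ w`. For `w ≠ 0` this is the module `L(λ, μ)`. -/
def whittakerImage (μ : Module.Dual ℂ T.cartan) (χ : LieAlgebra.LieCharacter ℂ T.pos)
    (w : whittakerVectors T.pos χ (T.DualLowestVerma μ)) :
    LieSubmodule ℂ g (T.DualLowestVerma μ) :=
  (whittakerHom w).range

end TriangularDecomposition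

end WhittakerModules

end

/-!
Let `g = p ⊕ b`. The module induced from a character of `b` is free of rank one over `U(p)`. No
Poincaré–Birkhoff–Witt theorem is needed for this: a left inverse of the orbit map from `U(p)`
comes from an explicit action of `g` on `U(p)`. Hence a functional on which `p` acts through a
character is determined by its value at the generator, and this value is arbitrary. With `p = n₊`
and `b = h ⊕ n₋` this gives the dimension of `W_λ(N(-μ)*)`.

If `N` is simple, no nonzero vector of `N` is killed by all functionals of a nonzero submodule
`P ⊆ N*`, so `Ann P` is the preimage of `Ann N` under the antipode and does not depend on `P`.
Twisting by `-σ` turns `M(μ)` into `N(-μ)`, so `N(-μ)` is simple when `M(μ)` is. Finally, the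
uniqueness of the `n₊`-invariant functional on `N(-μ)` forces it to have weight `μ`, so the simple
module `M(μ)` embeds in `N(-μ)*` and can be taken for `P`.
-/

noncomputable section

open UniversalEnvelopingAlgebra (ι lift)

local notation "𝓤" => UniversalEnvelopingAlgebra

namespace WhittakerModules

section Envelope

variable {R L : Type*} [CommRing R] [LieRing L] [LieAlgebra R L]

theorem adjoin_range_envelope_ι : Algebra.adjoin R (Set.range (ι R : L → 𝓤 R L)) = ⊤ := by
  have mk_surjective : Function.Surjective (UniversalEnvelopingAlgebra.mkAlgHom R L) :=
    RingCon.mkₐ_surjective _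
  have h := congrArg (Subalgebra.map (UniversalEnvelopingAlgebra.mkAlgHom R L))
    (TensorAlgebra.adjoin_range_ι (R := R) (M := L))
  rw [AlgHom.map_adjoin, Algebra.map_top, (AlgHom.range_eq_top _).2 mk_surjective,
    ← Set.range_comp] at h
  exact h

@[elab_as_elim]
theorem envelope_induction {P : 𝓤 R L → Prop} (algebraMap : ∀ r, P (algebraMap R (𝓤 R L) r))
    (add : ∀ u v, P u → P v → P (u + v)) (ι_mul : ∀ x u, P u → P (ι R x * u))
    (u : 𝓤 R L) : P u := by
  have smul_monomial : ∀ s ∈ Submonoid.closure (Set.range (ι R : L → 𝓤 R L)),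
      ∀ r : R, P (r • s) := by
    intro s hs
    induction hs using Submonoid.closure_induction_left with
    | one => exact fun r => Algebra.algebraMap_eq_smul_one (A := 𝓤 R L) r ▸ algebraMap r
    | mul_left _ hx s _ ih =>
      obtain ⟨x, rfl⟩ := hx
      exact fun r => mul_smul_comm r (ι R x) s ▸ ι_mul x _ (ih r)
  have hu : u ∈ Submodule.span R (Submonoid.closure (Set.range (ι R : L → 𝓤 R L)) : Set _) := by
    rw [← Algebra.adjoin_eq_span, adjoin_range_envelope_ι]
    exact Submodule.mem_top
  induction hu using Submodule.closure_induction with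
  | zero => simpa using algebraMap 0
  | add u v _ _ hu hv => exact add u v hu hv
  | smul_mem r s hs => exact smul_monomial s hs r

/-- The enveloping algebra as a Lie module, by left multiplication. -/
instance : LieRingModule L (𝓤 R L) where
  bracket x u := ι R x * u
  add_lie x y u := by rw [map_add, add_mul]
  lie_add x u v := mul_add _ u v
  leibniz_lie x y u := by
    rw [LieHom.map_lie, LieRing.of_associative_ring_bracket]
    noncomm_ring

theorem lie_envelope (x : L) (u : 𝓤 R L) : ⁅x, u⁆ = ι R x * u := rfl

instance : LieModule R L (𝓤 R L) where
  smul_lie t x u := by rw [lie_envelope, map_smul, smul_mul_assoc, lie_envelope]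
  lie_smul t x u := mul_smul_comm t (ι R x) u

variable (R L) (M : Type*) [AddCommGroup M] [Module R M] [LieRingModule L M] [LieModule R L M]

/-- The action of the universal enveloping algebra of `L` on an `L`-module. -/
abbrev envAction : 𝓤 R L →ₐ[R] Module.End R M := lift R (LieModule.toEnd R L M)

variable {R L M}

theorem envAction_ι_mul (x : L) (u : 𝓤 R L) (m : M) :
    envAction R L M (ι R x * u) m = ⁅x, envAction R L M u m⁆ := by
  simp

/-- The homomorphism `u ↦ u m` from the enveloping algebra to a Lie module. -/
def envOrbit (m : M) : 𝓤 R L →ₗ⁅R,L⁆ M where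
  toLinearMap := LinearMap.applyₗ m ∘ₗ (envAction R L M).toLinearMap
  map_lie' {x u} := envAction_ι_mul x u m

theorem envOrbit_one (m : M) : envOrbit m (1 : 𝓤 R L) = m :=
  congrArg (· m) (map_one (envAction R L M))

theorem map_envAction {N : Type*} [AddCommGroup N] [Module R N] [LieRingModule L N]
    [LieModule R L N] (f : M →ₗ⁅R,L⁆ N) (u : 𝓤 R L) (m : M) :
    f (envAction R L M u m) = envAction R L N u (f m) := by
  induction u using envelope_induction with
  | algebraMap r => simp [Module.algebraMap_end_apply]
  | add u v hu hv => simp only [map_add, LinearMap.add_apply, hu, hv]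
  | ι_mul x u hu => rw [envAction_ι_mul, envAction_ι_mul, LieModuleHom.map_lie, hu]

variable (R L) in
/-- The antipode of the universal enveloping algebra of `L`: the anti-automorphism with
`x ↦ -x` on `L`, encoded as a homomorphism to the opposite algebra. -/
def antipode : 𝓤 R L →ₐ[R] (𝓤 R L)ᵐᵒᵖ :=
  lift R
    { toLinearMap := -((MulOpposite.opLinearEquiv R).toLinearMap ∘ₗ (ι R : L →ₗ⁅R⁆ 𝓤 R L))
      map_lie' := fun {x y} => by
        simp [LieRing.of_associative_ring_bracket] }

theorem antipode_ι (x : L) : antipode R L (ι R x) = MulOpposite.op (-ι R x) :=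
  UniversalEnvelopingAlgebra.lift_ι_apply R _ x

theorem envAction_dual_apply (u : 𝓤 R L) (f : Module.Dual R M) (m : M) :
    envAction R L (Module.Dual R M) u f m = f (envAction R L M (antipode R L u).unop m) := by
  induction u using envelope_induction generalizing m with
  | algebraMap r => simp [Module.algebraMap_end_apply]
  | add u v hu hv => simp only [map_add, LinearMap.add_apply, MulOpposite.unop_add, hu, hv]
  | ι_mul x u hu =>
    rw [envAction_ι_mul, Module.Dual.lie_apply, hu, map_mul, antipode_ι]
    simp

end Envelope

section Irreducible

variable {R L M N : Type*} [CommRing R] [LieRing L] [AddCommGroup M] [Module R M]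
  [LieRingModule L M] [AddCommGroup N] [Module R N] [LieRingModule L N]

theorem isIrreducible_of_surjective [LieModule.IsIrreducible R L M] [Nontrivial N]
    (θ : L → L) (f : M →ₗ[R] N) (hf : Function.Surjective f) (hlie : ∀ x m, f ⁅x, m⁆ = ⁅θ x, f m⁆) :
    LieModule.IsIrreducible R L N := by
  refine LieModule.IsIrreducible.mk fun P hP => ?_
  let K : LieSubmodule R L M :=
    { P.toSubmodule.comap f with
      lie_mem := fun {x m} hm => by
        change f ⁅x, m⁆ ∈ P
        exact hlie x m ▸ P.lie_mem hm }
  rcases eq_bot_or_eq_top K with hK | hK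
  · refine absurd ((LieSubmodule.eq_bot_iff P).2 fun n hn => ?_) hP
    obtain ⟨m, rfl⟩ := hf n
    have hm : m ∈ K := hn
    rw [hK, LieSubmodule.mem_bot] at hm
    rw [hm, map_zero]
  · refine eq_top_iff.2 fun n _ => ?_
    obtain ⟨m, rfl⟩ := hf n
    exact (hK ▸ LieSubmodule.mem_top m : m ∈ K)

theorem injective_of_ne_zero [LieModule.IsIrreducible R L M] {f : M →ₗ⁅R,L⁆ N} (hf : f ≠ 0) :
    Function.Injective f := by
  refine (LieModuleHom.ker_eq_bot f).1 ((eq_bot_or_eq_top f.ker).resolve_right fun h => hf ?_)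
  ext m
  exact LieModuleHom.mem_ker.1 (h ▸ LieSubmodule.mem_top m)

theorem range_ne_bot_of_ne_zero {f : M →ₗ⁅R,L⁆ N} (hf : f ≠ 0) : f.range ≠ ⊥ := by
  refine fun h => hf (LieModuleHom.ext fun m => ?_)
  exact (LieSubmodule.eq_bot_iff _).1 h _ ((LieModuleHom.mem_range f _).2 ⟨m, rfl⟩)

variable [LieAlgebra R L] [LieModule R L M]

/-- The common kernel of the functionals in a submodule of the dual of a Lie module. -/
def lieDualCoannihilator (P : LieSubmodule R L (Module.Dual R M)) : LieSubmodule R L M where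
  toSubmodule := P.toSubmodule.dualCoannihilator
  lie_mem := by
    intro x m hm
    refine (Submodule.mem_dualCoannihilator _).2 fun f hf => ?_
    have h := (Submodule.mem_dualCoannihilator m).1 hm _ (P.lie_mem (x := x) hf)
    rwa [Module.Dual.lie_apply, neg_eq_zero] at h

theorem mem_lieDualCoannihilator {P : LieSubmodule R L (Module.Dual R M)} {m : M} :
    m ∈ lieDualCoannihilator P ↔ ∀ f ∈ P, f m = 0 :=
  Submodule.mem_dualCoannihilator m

theorem lieDualCoannihilator_eq_bot [LieModule.IsIrreducible R L M]
    {P : LieSubmodule R L (Module.Dual R M)} (hP : P ≠ ⊥) : lieDualCoannihilator P = ⊥ := by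
  refine (eq_bot_or_eq_top _).resolve_right fun h => hP ?_
  refine (LieSubmodule.eq_bot_iff P).2 fun f hf => LinearMap.ext fun m => ?_
  exact mem_lieDualCoannihilator.1 (h ▸ LieSubmodule.mem_top m) f hf

end Irreducible

section Annihilator

variable {L M N : Type*} [LieRing L] [LieAlgebra ℂ L]
  [AddCommGroup M] [Module ℂ M] [LieRingModule L M] [LieModule ℂ L M]
  [AddCommGroup N] [Module ℂ N] [LieRingModule L N] [LieModule ℂ L N]

theorem mem_annihilator {u : 𝓤 ℂ L} : u ∈ annihilator L M ↔ ∀ m, envAction ℂ L M u m = 0 :=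
  LinearMap.ext_iff

theorem mem_annihilator_lieSubmodule {P : LieSubmodule ℂ L M} {u : 𝓤 ℂ L} :
    u ∈ annihilator L P ↔ ∀ m ∈ P, envAction ℂ L M u m = 0 := by
  rw [mem_annihilator, Subtype.forall]
  refine forall₂_congr fun m hm => ?_
  rw [← ZeroMemClass.coe_eq_zero]
  exact iff_of_eq (congrArg (· = 0) (map_envAction P.incl u ⟨m, hm⟩))

theorem annihilator_range_of_injective {f : M →ₗ⁅ℂ,L⁆ N} (hf : Function.Injective f) :
    annihilator L f.range = annihilator L M := by
  ext u
  rw [mem_annihilator_lieSubmodule, mem_annihilator]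
  simp only [LieModuleHom.mem_range, forall_exists_index, forall_apply_eq_imp_iff,
    ← map_envAction, map_eq_zero_iff f hf]

theorem mem_annihilator_iff_antipode_mem [LieModule.IsIrreducible ℂ L N]
    {P : LieSubmodule ℂ L (Module.Dual ℂ N)} (hP : P ≠ ⊥) {u : 𝓤 ℂ L} :
    u ∈ annihilator L P ↔ (antipode ℂ L u).unop ∈ annihilator L N := by
  have apply_mem_coannihilator : u ∈ annihilator L P ↔
      ∀ m, envAction ℂ L N (antipode ℂ L u).unop m ∈ lieDualCoannihilator P := by
    simp only [mem_annihilator_lieSubmodule, mem_lieDualCoannihilator, LinearMap.ext_iff,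
      envAction_dual_apply, LinearMap.zero_apply]
    exact ⟨fun h m f hf => h f hf m, fun h f hf m => h m f hf⟩
  rw [apply_mem_coannihilator, lieDualCoannihilator_eq_bot hP, mem_annihilator]
  simp only [LieSubmodule.mem_bot]

theorem annihilator_eq_of_ne_bot_dual [LieModule.IsIrreducible ℂ L N]
    {P Q : LieSubmodule ℂ L (Module.Dual ℂ N)} (hP : P ≠ ⊥) (hQ : Q ≠ ⊥) :
    annihilator L P = annihilator L Q := by
  ext u
  rw [mem_annihilator_iff_antipode_mem hP, mem_annihilator_iff_antipode_mem hQ]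

end Annihilator

section Complement

variable {R g : Type*} [CommRing R] [LieRing g] [LieAlgebra R g]
  {p b : LieSubalgebra R g} (hpb : IsCompl p.toSubmodule b.toSubmodule)
  (χ : LieAlgebra.LieCharacter R b)

/-- The linear map `g = p ⊕ b → U(p)` given by the inclusion of `p` and by the character `χ`
of `b`. It describes the action of `g` on the generator of the module induced from `χ`, when that
module is identified with `U(p)`. -/
def generatorAction : g →ₗ[R] 𝓤 R p :=
  LinearMap.ofIsCompl hpb (ι R : p →ₗ⁅R⁆ 𝓤 R p).toLinearMap
    (Algebra.linearMap R (𝓤 R p) ∘ₗ χ.toLinearMap)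

theorem generatorAction_left (x : p) : generatorAction hpb χ (x : g) = ι R x :=
  LinearMap.ofIsCompl_apply_left hpb x

theorem generatorAction_right (y : b) :
    generatorAction hpb χ (y : g) = algebraMap R (𝓤 R p) (χ y) :=
  LinearMap.ofIsCompl_apply_right hpb y

/-- The operators on `U(p)` by which `g = p ⊕ b` acts on the module induced from the character `χ`
of `b`, when that module is identified with `U(p)`. If `v` is a vector of a `g`-module, then
`u ↦ (c ↦ c u v)` is a homomorphism of `p`-modules defined on `U(p)`, so it is determined by its
value `c ↦ c v` at `1`; this dictates the definition. -/
def complementAction : g →ₗ[R] Module.End R (𝓤 R p) :=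
  LinearMap.flip (envOrbit (generatorAction hpb χ)).toLinearMap

theorem complementAction_one (c : g) :
    complementAction hpb χ c 1 = generatorAction hpb χ c :=
  congrArg (· c) (envOrbit_one (generatorAction hpb χ))

theorem complementAction_ι_mul (c : g) (x : p) (u : 𝓤 R p) :
    complementAction hpb χ c (ι R x * u)
      = ι R x * complementAction hpb χ c u + complementAction hpb χ ⁅c, (x : g)⁆ u := by
  have h : complementAction hpb χ c (ι R x * u)
      = ι R x * complementAction hpb χ c u - complementAction hpb χ ⁅(x : g), c⁆ u :=
    congrArg (· c) ((envOrbit (generatorAction hpb χ)).map_lie x u)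
  rw [h, ← lie_skew c (x : g), map_neg, LinearMap.neg_apply, sub_eq_add_neg]

theorem complementAction_left (x : p) (u : 𝓤 R p) :
    complementAction hpb χ (x : g) u = ι R x * u := by
  induction u using envelope_induction generalizing x with
  | algebraMap r =>
    rw [Algebra.algebraMap_eq_smul_one, map_smul, complementAction_one, generatorAction_left,
      mul_smul_comm, mul_one]
  | add u v hu hv => rw [map_add, hu, hv, mul_add]
  | ι_mul y u hu =>
    rw [complementAction_ι_mul, hu x, ← LieSubalgebra.coe_bracket, hu, LieHom.map_lie,
      LieRing.of_associative_ring_bracket]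
    noncomm_ring

theorem complementAction_right_one (y : b) : complementAction hpb χ (y : g) 1 = χ y • 1 := by
  rw [complementAction_one, generatorAction_right, Algebra.algebraMap_eq_smul_one]

theorem complementAction_lie_left_one (c : g) (x : p) :
    complementAction hpb χ ⁅c, (x : g)⁆ 1
      = ⁅complementAction hpb χ c, complementAction hpb χ (x : g)⁆ 1 := by
  rw [LieRing.of_associative_ring_bracket, LinearMap.sub_apply, Module.End.mul_apply,
    Module.End.mul_apply, complementAction_left, complementAction_left, complementAction_ι_mul,
    add_sub_cancel_left]

theorem complementAction_lie_right_one (y z : b) :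
    complementAction hpb χ ⁅(y : g), (z : g)⁆ 1
      = ⁅complementAction hpb χ (y : g), complementAction hpb χ (z : g)⁆ 1 := by
  rw [LieRing.of_associative_ring_bracket, LinearMap.sub_apply, Module.End.mul_apply,
    Module.End.mul_apply, ← LieSubalgebra.coe_bracket]
  simp only [complementAction_right_one, map_smul, smul_smul, LieAlgebra.lieCharacter_apply_lie,
    mul_comm, sub_self, zero_smul]

theorem complementAction_lie_one (c d : g) :
    complementAction hpb χ ⁅c, d⁆ 1 = ⁅complementAction hpb χ c, complementAction hpb χ d⁆ 1 := by
  obtain ⟨x, hx, y, hy, rfl⟩ := Submodule.mem_sup.1 (hpb.sup_eq_top ▸ Submodule.mem_top (x := c))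
  obtain ⟨x', hx', z, hz, rfl⟩ := Submodule.mem_sup.1 (hpb.sup_eq_top ▸ Submodule.mem_top (x := d))
  have left := complementAction_lie_left_one hpb χ (x + y) ⟨x', hx'⟩
  have left_skew := complementAction_lie_left_one hpb χ z ⟨x, hx⟩
  have right := complementAction_lie_right_one hpb χ ⟨y, hy⟩ ⟨z, hz⟩
  rw [← lie_skew, ← lie_skew (complementAction hpb χ z), map_neg, LinearMap.neg_apply,
    LinearMap.neg_apply, neg_inj] at left_skew
  simp only [lie_add, map_add, LinearMap.add_apply] at left ⊢
  rw [left]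
  simp only [add_lie, map_add, LinearMap.add_apply]
  rw [left_skew, right]

theorem complementAction_lie (c d : g) (u : 𝓤 R p) :
    complementAction hpb χ ⁅c, d⁆ u
      = ⁅complementAction hpb χ c, complementAction hpb χ d⁆ u := by
  induction u using envelope_induction generalizing c d with
  | algebraMap r =>
    rw [Algebra.algebraMap_eq_smul_one, map_smul, map_smul, complementAction_lie_one]
  | add u v hu hv => rw [map_add, map_add, hu, hv]
  | ι_mul x u hu =>
    simp only [LieRing.of_associative_ring_bracket, LinearMap.sub_apply, Module.End.mul_apply]
      at hu ⊢
    simp only [complementAction_ι_mul, map_add]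
    rw [lie_lie, map_sub, LinearMap.sub_apply, hu c d, hu c ⁅d, (x : g)⁆, hu d ⁅c, (x : g)⁆]
    noncomm_ring

/-- The representation of `g = p ⊕ b` on `U(p)` that extends left multiplication by `p` and for
which `b` acts on `1` through the character `χ`. -/
def complementRep : g →ₗ⁅R⁆ Module.End R (𝓤 R p) where
  toLinearMap := complementAction hpb χ
  map_lie' {c d} := LinearMap.ext (complementAction_lie hpb χ c d)

theorem complementRep_left (x : p) (u : 𝓤 R p) : complementRep hpb χ (x : g) u = ι R x * u :=
  complementAction_left hpb χ x u

theorem complementRep_right_one (y : b) : complementRep hpb χ (y : g) 1 = χ y • 1 :=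
  complementAction_right_one hpb χ y

end Complement

namespace Induced

variable {g : Type*} [LieRing g] [LieAlgebra ℂ g] (s : LieSubalgebra ℂ g)
  (χ : LieAlgebra.LieCharacter ℂ s)

/-- The generator `1 ⊗ 1` of the module induced from a character. -/
abbrev generator : Induced s (charRep χ) := standardGenerator s χ

theorem lie_generator (a : s) : ⁅(a : g), generator s χ⁆ = χ a • generator s χ := by
  refine (Submodule.Quotient.eq _).2 (Submodule.subset_span ⟨1, ι ℂ a, 1, ?_⟩)
  simp [envIncl, charRep, TensorProduct.smul_tmul', TensorProduct.smul_tmul]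

variable {s χ}

theorem exists_smul_generator (m : Induced s (charRep χ)) :
    ∃ u : 𝓤 ℂ g, u • generator s χ = m := by
  obtain ⟨t, rfl⟩ := (balancing s (charRep χ)).mkQ_surjective m
  obtain ⟨u, rfl⟩ := (TensorProduct.rid ℂ (𝓤 ℂ g)).symm.surjective t
  refine ⟨u, congrArg (balancing s (charRep χ)).mkQ (?_ : u • ((1 : 𝓤 ℂ g) ⊗ₜ[ℂ] (1 : ℂ)) = _)⟩
  rw [TensorProduct.smul_tmul', smul_eq_mul, mul_one, TensorProduct.rid_symm_apply]

theorem eq_top_of_generator_mem {P : Submodule ℂ (Induced s (charRep χ))}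
    (hgen : generator s χ ∈ P) (hlie : ∀ (x : g), ∀ m ∈ P, ⁅x, m⁆ ∈ P) : P = ⊤ := by
  refine Submodule.eq_top_iff'.2 fun m => ?_
  obtain ⟨u, rfl⟩ := exists_smul_generator m
  induction u using envelope_induction with
  | algebraMap t => exact (algebraMap_smul (𝓤 ℂ g) t (generator s χ)).symm ▸ P.smul_mem t hgen
  | add u v hu hv => exact add_smul u v (generator s χ) ▸ P.add_mem hu hv
  | ι_mul x u hu => exact mul_smul (ι ℂ x) u (generator s χ) ▸ hlie x _ hu

variable {W : Type*} [AddCommGroup W] [Module ℂ W] (ρ : g →ₗ⁅ℂ⁆ Module.End ℂ W) {w : W}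
  (hw : ∀ a : s, ρ (a : g) w = χ a • w)

/-- Frobenius reciprocity: the map from the module induced from `χ` to the space of a
representation `ρ` that sends the generator to a given vector of weight `χ`. -/
def liftRep : Induced s (charRep χ) →ₗ[ℂ] W :=
  letI : LieRingModule g W := LieRingModule.compLieHom W ρ
  haveI : LieModule ℂ g W := LieModule.compLieHom W ρ
  whittakerHom (⟨w, hw⟩ : whittakerVectors s χ W)

theorem liftRep_generator : liftRep ρ hw (generator s χ) = w :=
  letI : LieRingModule g W := LieRingModule.compLieHom W ρ
  haveI : LieModule ℂ g W := LieModule.compLieHom W ρ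
  whittakerHom_generator (⟨w, hw⟩ : whittakerVectors s χ W)

theorem liftRep_lie (x : g) (m : Induced s (charRep χ)) :
    liftRep ρ hw ⁅x, m⁆ = ρ x (liftRep ρ hw m) :=
  letI : LieRingModule g W := LieRingModule.compLieHom W ρ
  haveI : LieModule ℂ g W := LieModule.compLieHom W ρ
  LieModuleHom.map_lie (whittakerHom (⟨w, hw⟩ : whittakerVectors s χ W)) x m

end Induced

section Whittaker

variable {g : Type*} [LieRing g] [LieAlgebra ℂ g] {p b : LieSubalgebra ℂ g}
  (hpb : IsCompl p.toSubmodule b.toSubmodule) (χ : LieAlgebra.LieCharacter ℂ b)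

include hpb in
theorem envOrbit_generator_surjective :
    Function.Surjective (envOrbit (R := ℂ) (L := p) (Induced.generator b χ)) := by
  set orbit := envOrbit (R := ℂ) (L := p) (Induced.generator b χ)
  have orbit_one : orbit 1 = Induced.generator b χ := envOrbit_one _
  have orbit_ι_mul (x : p) (u : 𝓤 ℂ p) : orbit (ι ℂ x * u) = ⁅(x : g), orbit u⁆ :=
    orbit.map_lie x u
  have lie_mem_range (c : g) (u : 𝓤 ℂ p) : ⁅c, orbit u⁆ ∈ LinearMap.range orbit.toLinearMap := by
    induction u using envelope_induction generalizing c with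
    | algebraMap t =>
      obtain ⟨x, hx, y, hy, rfl⟩ :=
        Submodule.mem_sup.1 (hpb.sup_eq_top ▸ Submodule.mem_top (x := c))
      have orbit_left : orbit (ι ℂ ⟨x, hx⟩) = ⁅x, Induced.generator b χ⁆ := by
        rw [← mul_one (ι ℂ _), orbit_ι_mul, orbit_one]
      have orbit_right : orbit (χ ⟨y, hy⟩ • 1) = ⁅y, Induced.generator b χ⁆ := by
        rw [map_smul, orbit_one]
        exact (Induced.lie_generator b χ ⟨y, hy⟩).symm
      rw [Algebra.algebraMap_eq_smul_one, map_smul, lie_smul, orbit_one, add_lie]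
      exact Submodule.smul_mem _ t (Submodule.add_mem _ ⟨_, orbit_left⟩ ⟨_, orbit_right⟩)
    | add u v hu hv =>
      rw [map_add, lie_add]
      exact Submodule.add_mem _ (hu c) (hv c)
    | ι_mul x u hu =>
      obtain ⟨v, hv⟩ := hu c
      rw [orbit_ι_mul, leibniz_lie]
      exact Submodule.add_mem _ (hu _) ⟨ι ℂ x * v, (orbit_ι_mul x v).trans (congrArg _ hv)⟩
  refine LinearMap.range_eq_top.1 (Induced.eq_top_of_generator_mem ⟨1, orbit_one⟩ ?_)
  rintro c _ ⟨u, rfl⟩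
  exact lie_mem_range c u

include hpb in
theorem envOrbit_generator_injective :
    Function.Injective (envOrbit (R := ℂ) (L := p) (Induced.generator b χ)) := by
  let retract := Induced.liftRep (complementRep hpb χ) (complementRep_right_one hpb χ)
  refine Function.LeftInverse.injective (g := retract) fun u => ?_
  induction u using envelope_induction with
  | algebraMap t =>
    rw [Algebra.algebraMap_eq_smul_one, map_smul, map_smul, envOrbit_one,
      Induced.liftRep_generator]
  | add u v hu hv => rw [map_add, map_add, hu, hv]
  | ι_mul x u hu =>
    rw [← lie_envelope, LieModuleHom.map_lie, LieSubalgebra.coe_bracket_of_module,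
      Induced.liftRep_lie, hu, complementRep_left, lie_envelope]

/-- If `g = p ⊕ b`, the module induced from a character of `b` is free of rank one over `U(p)`. -/
def envOrbitEquiv : 𝓤 ℂ p ≃ₗ[ℂ] Induced b (charRep χ) :=
  LinearEquiv.ofBijective (envOrbit (R := ℂ) (L := p) (Induced.generator b χ)).toLinearMap
    ⟨envOrbit_generator_injective hpb χ, envOrbit_generator_surjective hpb χ⟩

theorem envOrbitEquiv_one : envOrbitEquiv hpb χ 1 = Induced.generator b χ :=
  envOrbit_one (R := ℂ) (L := p) (Induced.generator b χ)

theorem envOrbitEquiv_ι_mul (x : p) (u : 𝓤 ℂ p) :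
    envOrbitEquiv hpb χ (ι ℂ x * u) = ⁅(x : g), envOrbitEquiv hpb χ u⁆ :=
  (envOrbit (R := ℂ) (L := p) (Induced.generator b χ)).map_lie x u

section Functional

variable {L : Type*} [LieRing L] [LieAlgebra ℂ L] (ψ : LieAlgebra.LieCharacter ℂ L)

/-- The functional on `U(L)` that is multiplied by `-ψ(x)` under left multiplication by `x ∈ L`
and that takes the value `1` at `1`. -/
def whittakerFunctional : Module.Dual ℂ (𝓤 ℂ L) :=
  (lift ℂ ψ).toLinearMap ∘ₗ (MulOpposite.opLinearEquiv ℂ).symm.toLinearMap ∘ₗ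
    (antipode ℂ L).toLinearMap

theorem whittakerFunctional_apply (u : 𝓤 ℂ L) :
    whittakerFunctional ψ u = lift ℂ ψ (antipode ℂ L u).unop := rfl

theorem whittakerFunctional_one : whittakerFunctional ψ 1 = 1 := by
  rw [whittakerFunctional_apply, map_one, MulOpposite.unop_one, map_one]

theorem whittakerFunctional_ι_mul (x : L) (u : 𝓤 ℂ L) :
    whittakerFunctional ψ (ι ℂ x * u) = -(ψ x * whittakerFunctional ψ u) := by
  rw [whittakerFunctional_apply, map_mul, antipode_ι, MulOpposite.unop_mul, MulOpposite.unop_op,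
    map_mul, map_neg, UniversalEnvelopingAlgebra.lift_ι_apply, mul_neg, mul_comm,
    whittakerFunctional_apply]

end Functional

variable {χ} {ψ : LieAlgebra.LieCharacter ℂ p}

theorem mem_whittakerVectors_dual {M : Type*} [AddCommGroup M] [Module ℂ M]
    [LieRingModule g M] [LieModule ℂ g M] {f : Module.Dual ℂ M} :
    f ∈ whittakerVectors p ψ (Module.Dual ℂ M) ↔ ∀ (x : p) m, f ⁅(x : g), m⁆ = -(ψ x * f m) := by
  refine forall_congr' fun x => LinearMap.ext_iff.trans (forall_congr' fun m => ?_)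
  rw [Module.Dual.lie_apply, LinearMap.smul_apply, smul_eq_mul, neg_eq_iff_eq_neg]

include hpb in
theorem eq_zero_of_apply_generator_eq_zero {f : Module.Dual ℂ (Induced b (charRep χ))}
    (hf : f ∈ whittakerVectors p ψ _) (hgen : f (Induced.generator b χ) = 0) : f = 0 := by
  rw [mem_whittakerVectors_dual] at hf
  refine LinearMap.ext fun m => ?_
  obtain ⟨u, rfl⟩ := (envOrbitEquiv hpb χ).surjective m
  rw [LinearMap.zero_apply]
  induction u using envelope_induction with
  | algebraMap t =>
    rw [Algebra.algebraMap_eq_smul_one, map_smul, map_smul, envOrbitEquiv_one, hgen, smul_zero]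
  | add u v hu hv => rw [map_add, map_add, hu, hv, add_zero]
  | ι_mul x u hu => rw [envOrbitEquiv_ι_mul, hf, hu, mul_zero, neg_zero]

theorem whittakerFunctional_comp_mem_whittakerVectors :
    whittakerFunctional ψ ∘ₗ (envOrbitEquiv hpb χ).symm.toLinearMap ∈
      whittakerVectors p ψ (Module.Dual ℂ (Induced b (charRep χ))) := by
  refine mem_whittakerVectors_dual.2 fun x m => ?_
  obtain ⟨u, rfl⟩ := (envOrbitEquiv hpb χ).surjective m
  simp only [LinearMap.comp_apply, LinearEquiv.coe_coe, ← envOrbitEquiv_ι_mul,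
    LinearEquiv.symm_apply_apply, whittakerFunctional_ι_mul]

variable (χ ψ) in
/-- If `g = p ⊕ b`, evaluation at the generator identifies the Whittaker functionals on the module
induced from a character of `b` with the scalars. -/
def whittakerVectorsDualEquiv :
    whittakerVectors p ψ (Module.Dual ℂ (Induced b (charRep χ))) ≃ₗ[ℂ] ℂ :=
  LinearEquiv.ofBijective
    (LinearMap.applyₗ (Induced.generator b χ) ∘ₗ (whittakerVectors p ψ _).subtype) <| by
  refine ⟨(injective_iff_map_eq_zero _).2 fun f hf =>
    Subtype.ext (eq_zero_of_apply_generator_eq_zero hpb f.2 hf), fun t =>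
      ⟨t • ⟨_, whittakerFunctional_comp_mem_whittakerVectors hpb⟩, ?_⟩⟩
  rw [map_smul, smul_eq_mul, LinearMap.comp_apply, Submodule.subtype_apply,
    LinearMap.applyₗ_apply_apply, LinearMap.comp_apply, LinearEquiv.coe_coe,
    ← envOrbitEquiv_one hpb χ, LinearEquiv.symm_apply_apply, whittakerFunctional_one, mul_one]

theorem whittakerVectorsDualEquiv_apply (f : whittakerVectors p ψ (Module.Dual ℂ _)) :
    whittakerVectorsDualEquiv hpb χ ψ f = (f : Module.Dual ℂ _) (Induced.generator b χ) := rfl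

include hpb in
variable (χ) in
theorem nontrivial_induced : Nontrivial (Induced b (charRep χ)) := by
  refine ⟨Induced.generator b χ, 0, fun h => ?_⟩
  have eval_eq_one := (whittakerVectorsDualEquiv hpb χ 0).apply_symm_apply 1
  rw [whittakerVectorsDualEquiv_apply, h, map_zero] at eval_eq_one
  exact zero_ne_one eval_eq_one

section Module

variable {n : LieSubalgebra ℂ g} {M : Type*} [AddCommGroup M] [Module ℂ M] [LieRingModule g M]
  [LieModule ℂ g M]

theorem whittakerHom_ne_zero {χ : LieAlgebra.LieCharacter ℂ n} {w : whittakerVectors n χ M}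
    (hw : w ≠ 0) : whittakerHom w ≠ 0 := by
  refine fun h => hw (Subtype.ext ?_)
  rw [← whittakerHom_generator w, h]
  rfl

theorem mem_whittakerVectors_zero {m : M} :
    m ∈ whittakerVectors n 0 M ↔ ∀ y ∈ n, ⁅y, m⁆ = 0 :=
  Subtype.forall.trans (forall₂_congr fun y _ => by
    rw [LieHom.zero_apply, zero_smul])

theorem lie_mem_whittakerVectors_zero {m : M} (hm : m ∈ whittakerVectors n 0 M) {x : g}
    (hx : ∀ y ∈ n, ⁅x, y⁆ ∈ n) : ⁅x, m⁆ ∈ whittakerVectors n 0 M := by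
  rw [mem_whittakerVectors_zero] at hm ⊢
  intro y hy
  rw [leibniz_lie, hm y hy, lie_zero, add_zero, ← lie_skew, neg_lie, hm _ (hx y hy), neg_zero]

end Module

end Whittaker

namespace TriangularDecomposition

variable {g : Type*} [LieRing g] [LieAlgebra ℂ g] (T : TriangularDecomposition g)

theorem isCompl_pos_borel :
    IsCompl T.pos.toSubmodule (T.borel T.neg T.cartan_lie_neg).toSubmodule := by
  obtain ⟨indep, span⟩ :=
    (DirectSum.isInternal_submodule_iff_iSupIndep_and_iSup_eq_top _).1 T.isInternal
  rw [iSup_fin_three, sup_comm] at span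
  have isCompl : IsCompl T.pos.toSubmodule (T.neg.toSubmodule ⊔ T.cartan.toSubmodule) :=
    ⟨(iSupIndep_fin_three.1 indep).2.2, codisjoint_iff.2 span⟩
  rwa [sup_comm] at isCompl

variable {T} in
theorem forall_borel_eq_smul_iff {n : LieSubalgebra ℂ g} {hn : ∀ x ∈ T.cartan, ∀ y ∈ n, ⁅x, y⁆ ∈ n}
    {hle : n.toSubmodule ≤ T.neg.toSubmodule ⊔ T.pos.toSubmodule} {ν : Module.Dual ℂ T.cartan}
    {W : Type*} [AddCommGroup W] [Module ℂ W] {G : g →ₗ[ℂ] W} {w : W} :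
    (∀ y : T.borel n hn, G y = T.borelChar n hn hle ν y • w) ↔
      (∀ x : T.cartan, G x = ν x • w) ∧ ∀ y ∈ n, G y = 0 := by
  have proj_eq_zero (y : g) (hy : y ∈ n) : T.proj y = 0 :=
    (Submodule.projectionOnto_apply_eq_zero_iff T.isCompl_cartan).2 (hle hy)
  have borelChar_apply (y : T.borel n hn) : T.borelChar n hn hle ν y = ν (T.proj y) := rfl
  simp only [borelChar_apply]
  refine ⟨fun h => ⟨fun x => ?_, fun y hy => ?_⟩, ?_⟩
  · rw [h ⟨x, Submodule.mem_sup_left x.2⟩, T.proj_cartan]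
  · rw [h ⟨y, Submodule.mem_sup_right hy⟩, proj_eq_zero y hy, map_zero, zero_smul]
  · rintro ⟨hcartan, hzero⟩ ⟨_, hxy⟩
    obtain ⟨x, hx, y, hy, rfl⟩ := Submodule.mem_sup.1 hxy
    rw [map_add, map_add, proj_eq_zero y hy, hzero y hy, add_zero, add_zero, hcartan ⟨x, hx⟩,
      T.proj_cartan ⟨x, hx⟩]

/-- The generator of the lowest weight Verma module. -/
abbrev lowestVector (ν : Module.Dual ℂ T.cartan) : T.LowestVerma ν :=
  Induced.generator (T.borel T.neg T.cartan_lie_neg)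
    (T.borelChar T.neg T.cartan_lie_neg le_sup_left ν)

theorem lie_lowestVector (ν : Module.Dual ℂ T.cartan) :
    (∀ x : T.cartan, ⁅(x : g), T.lowestVector ν⁆ = ν x • T.lowestVector ν) ∧
      ∀ y ∈ T.neg, ⁅y, T.lowestVector ν⁆ = 0 :=
  forall_borel_eq_smul_iff (G := (LieModule.toEnd ℂ g _).toLinearMap.flip (T.lowestVector ν)).1
    (Induced.lie_generator _ _)

/-- The involution `-σ` of the Lie algebra `g`. -/
def chevalley : g →ₗ⁅ℂ⁆ g where
  toLinearMap := -T.sigma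
  map_lie' {x y} := by
    change -T.sigma ⁅x, y⁆ = ⁅-T.sigma x, -T.sigma y⁆
    rw [T.sigma_lie, neg_lie, lie_neg, neg_neg, lie_skew]

theorem chevalley_chevalley (x : g) : T.chevalley (T.chevalley x) = x := by
  change -T.sigma (-T.sigma x) = x
  rw [map_neg, neg_neg, T.sigma_sigma]

theorem chevalley_cartan (x : T.cartan) : T.chevalley (x : g) = -x :=
  congrArg Neg.neg (T.sigma_cartan x x.2)

theorem chevalley_mem_neg {x : g} (hx : x ∈ T.pos) : T.chevalley x ∈ T.neg :=
  T.neg.neg_mem (T.map_sigma.le ⟨x, hx, rfl⟩)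

variable (μ : Module.Dual ℂ T.cartan)

theorem chevalley_lie_lowestVector (y : T.borel T.pos T.cartan_lie_pos) :
    ⁅T.chevalley y, T.lowestVector (-μ)⁆
      = T.borelChar T.pos T.cartan_lie_pos le_sup_right μ y • T.lowestVector (-μ) := by
  obtain ⟨cartan_lie, neg_lie_eq_zero⟩ := T.lie_lowestVector (-μ)
  refine forall_borel_eq_smul_iff (G := (LieModule.toEnd ℂ g _).toLinearMap.flip
    (T.lowestVector (-μ)) ∘ₗ T.chevalley.toLinearMap).2 ⟨fun x => ?_, fun y hy => ?_⟩ y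
  · change ⁅T.chevalley x, T.lowestVector (-μ)⁆ = _
    rw [chevalley_cartan, neg_lie, cartan_lie, LinearMap.neg_apply, neg_smul, neg_neg]
  · exact neg_lie_eq_zero _ (T.chevalley_mem_neg hy)

theorem isIrreducible_lowestVerma [LieModule.IsIrreducible ℂ g (T.Verma μ)] :
    LieModule.IsIrreducible ℂ g (T.LowestVerma (-μ)) := by
  have : Nontrivial (T.LowestVerma (-μ)) := nontrivial_induced T.isCompl_pos_borel _
  let twist : T.Verma μ →ₗ[ℂ] T.LowestVerma (-μ) :=
    Induced.liftRep ((LieModule.toEnd ℂ g _).comp T.chevalley) (T.chevalley_lie_lowestVector μ)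
  have twist_lie (x : g) (m : T.Verma μ) : twist ⁅x, m⁆ = ⁅T.chevalley x, twist m⁆ :=
    Induced.liftRep_lie _ _ x m
  refine isIrreducible_of_surjective T.chevalley twist (LinearMap.range_eq_top.1 ?_) twist_lie
  refine Induced.eq_top_of_generator_mem ⟨_, Induced.liftRep_generator _ _⟩ ?_
  rintro x _ ⟨m, rfl⟩
  exact ⟨⁅T.chevalley x, m⁆, by rw [twist_lie, chevalley_chevalley]⟩

theorem finrank_whittakerVectors (χ : LieAlgebra.LieCharacter ℂ T.pos) :
    Module.finrank ℂ (whittakerVectors T.pos χ (T.DualLowestVerma μ)) = 1 :=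
  (whittakerVectorsDualEquiv T.isCompl_pos_borel _ χ).finrank_eq.trans (Module.finrank_self ℂ)

variable {T μ}

theorem cartan_lie_of_mem_whittakerVectors_zero {f : T.DualLowestVerma μ}
    (hf : f ∈ whittakerVectors T.pos 0 (T.DualLowestVerma μ)) (x : T.cartan) :
    ⁅(x : g), f⁆ = μ x • f := by
  refine sub_eq_zero.1 (eq_zero_of_apply_generator_eq_zero T.isCompl_pos_borel
    (Submodule.sub_mem _ (lie_mem_whittakerVectors_zero hf (T.cartan_lie_pos x x.2))
      (Submodule.smul_mem _ _ hf)) ?_)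
  rw [LinearMap.sub_apply, Module.Dual.lie_apply, (T.lie_lowestVector (-μ)).1, map_smul,
    LinearMap.neg_apply, neg_smul, neg_neg, LinearMap.smul_apply, sub_self]

theorem mem_whittakerVectors_borel {f : T.DualLowestVerma μ}
    (hf : f ∈ whittakerVectors T.pos 0 (T.DualLowestVerma μ)) :
    f ∈ whittakerVectors (T.borel T.pos T.cartan_lie_pos)
      (T.borelChar T.pos T.cartan_lie_pos le_sup_right μ) (T.DualLowestVerma μ) :=
  forall_borel_eq_smul_iff (G := (LieModule.toEnd ℂ g _).toLinearMap.flip f).2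
    ⟨cartan_lie_of_mem_whittakerVectors_zero hf, mem_whittakerVectors_zero.1 hf⟩

variable (T μ) in
theorem exists_vermaHom_ne_zero : ∃ F : T.Verma μ →ₗ⁅ℂ,g⁆ T.DualLowestVerma μ, F ≠ 0 := by
  let f := (whittakerVectorsDualEquiv T.isCompl_pos_borel
    (T.borelChar T.neg T.cartan_lie_neg le_sup_left (-μ)) 0).symm 1
  have hf : f ≠ 0 := (LinearEquiv.map_ne_zero_iff _).2 one_ne_zero
  refine ⟨whittakerHom ⟨f, mem_whittakerVectors_borel f.2⟩, whittakerHom_ne_zero fun h => hf ?_⟩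
  exact Subtype.ext (congrArg (fun w => w.1) h)

theorem annihilator_eq_of_ne_bot [LieModule.IsIrreducible ℂ g (T.Verma μ)]
    {P : LieSubmodule ℂ g (T.DualLowestVerma μ)} (hP : P ≠ ⊥) :
    annihilator g P = annihilator g (T.Verma μ) := by
  have := T.isIrreducible_lowestVerma μ
  obtain ⟨F, hF⟩ := T.exists_vermaHom_ne_zero μ
  rw [← annihilator_range_of_injective (injective_of_ne_zero hF)]
  exact annihilator_eq_of_ne_bot_dual hP (range_ne_bot_of_ne_zero hF)

theorem whittakerImage_ne_bot {χ : LieAlgebra.LieCharacter ℂ T.pos}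
    {w : whittakerVectors T.pos χ (T.DualLowestVerma μ)} (hw : w ≠ 0) :
    T.whittakerImage μ χ w ≠ ⊥ :=
  range_ne_bot_of_ne_zero (whittakerHom_ne_zero hw)

end TriangularDecomposition

end WhittakerModules

end

open WhittakerModules in
theorem theorem50_general {g : Type*} [LieRing g] [LieAlgebra ℂ g] (T : TriangularDecomposition g)
    (μ : Module.Dual ℂ T.cartan) (χ : LieAlgebra.LieCharacter ℂ T.pos) :
    Module.finrank ℂ (whittakerVectors T.pos χ (T.DualLowestVerma μ)) = 1 ∧
      (LieModule.IsIrreducible ℂ g (T.Verma μ) →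
        ∀ P : LieSubmodule ℂ g (T.DualLowestVerma μ), P ≠ ⊥ →
          annihilator g P = annihilator g (T.Verma μ)) :=
  ⟨T.finrank_whittakerVectors μ χ,
    fun _ _ hP => TriangularDecomposition.annihilator_eq_of_ne_bot hP⟩

open WhittakerModules in
theorem theorem50 {g : Type*} [LieRing g] [LieAlgebra ℂ g] (T : TriangularDecomposition g)
    (μ : Module.Dual ℂ T.cartan) (hμ : LieModule.IsIrreducible ℂ g (T.Verma μ))
    (χ : LieAlgebra.LieCharacter ℂ T.pos) :
    Module.finrank ℂ (whittakerVectors T.pos χ (T.DualLowestVerma μ)) = 1 ∧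
      ∀ w : whittakerVectors T.pos χ (T.DualLowestVerma μ), w ≠ 0 →
        annihilator g (T.whittakerImage μ χ w) = annihilator g (T.Verma μ) := by
  obtain ⟨finrank_eq_one, annihilator_eq⟩ := theorem50_general T μ χ
  exact ⟨finrank_eq_one, fun _ hw =>
    annihilator_eq hμ _ (TriangularDecomposition.whittakerImage_ne_bot hw)⟩
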